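/- Let $\Sigma_2=\{0,1\}$. An \emph{overlap} is a word of the form $axaxa$, where $a$ is a letter and $x$ is a (possibly empty) word. A finite word is \emph{overlap-free} if none of its factors (contiguous subwords) is an overlap. An \emph{extension} of a word $w$ over $\Sigma_2$ is a word of the form $w'aw''$, where $a\in\Sigma_2$ and $w',w''$ are possibly empty words over $\Sigma_2$ with $w'w''=w$. The word $w$ is \emph{extremal overlap-free} if $w$ is overlap-free and every extension of $w$ contains an overlap as a factor. Let $n$ be a nonnegative integer. Then there is an extremal overlap-free word of length $n$ over $\Sigma_2$ if and only if $$n\in\{10,12\}\cup\{2k : k\in\mathbb{Z},\ k\geq 10\}\cup\{2^k+1 : k\in\mathbb{Z},\ k\geq 5\}\cup\{3\cdot 2^k+1 : k\in\mathbb{Z},\ k\geq 3\}.$$ -/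

import Mathlib

/-- An overlap: a word `a x a x a` with `a` a letter and `x` a possibly empty word. -/
def IsOverlap {α : Type*} (u : List α) : Prop :=
  ∃ (a : α) (x : List α), u = [a] ++ x ++ [a] ++ x ++ [a]

/-- `w` contains an overlap as a factor (`<:+:` is the contiguous-factor relation). -/
def ContainsOverlap {α : Type*} (w : List α) : Prop :=
  ∃ u : List α, IsOverlap u ∧ u <:+: w

/-- `w` contains no overlap as a factor. -/
def OverlapFree {α : Type*} (w : List α) : Prop :=
  ¬ ContainsOverlap w

/-- `v` is an extension of `w`: `v = w' a w''` with `w = w' w''` and `a` a letter. -/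
def IsExtension {α : Type*} (v w : List α) : Prop :=
  ∃ (w' w'' : List α) (a : α), w = w' ++ w'' ∧ v = w' ++ [a] ++ w''

/-- `w` is overlap-free and each of its extensions contains an overlap. -/
def ExtremalOverlapFree {α : Type*} (w : List α) : Prop :=
  OverlapFree w ∧ ∀ v : List α, IsExtension v w → ContainsOverlap v

/-! ### Overlaps by position -/

/-! Overlap-free binary words desubstitute: each is x·mu(y)·z with margins x, z of length at most 2
(`exists_factorization`), and `mu` preserves overlap-freeness. Hence, away from the ends, equal
adjacent letters sit at positions of one parity. An insertion deep inside shifts that parity on one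
side only and so creates an overlap; extremality is therefore a matter of the two ends
(`extremalOverlapFree_of_ends`).

Necessity. In odd length exactly one margin is a single letter. If the other is empty, one more
letter completes a `mu`-image and the word extends. Otherwise, up to reversal, w = aa·mu(y)·d;
appending the complement of d must create an overlap, which forces āyd itself to be an overlap. Then
āy is an overlap-free square, its period r is 2^k or 3·2^k (`square_period`), and |w| = 4r + 1.
Lengths below 20 are settled by enumeration.

Sufficiency. The prefix `headEight` turns every insertion near it into an overlap. Words of length m
with `headFour` at both ends exist for m ≥ 10 not a power of 2 (`hasEnds_four_four`); applying `mu`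
and switching the two extreme letters gives `headEight` at both ends in length 2m. For m a power of
2, iterates of `mu` on aaāāaaāā serve instead. For odd lengths, a square mu^k(u)mu^k(u) with u = 0
or 010 is conjugated by three letters and a 0 is prepended (`exists_extremal_of_square`); 25 and 49
are explicit. -/

theorem exists_overlap_prefix_iff (w : List Bool) :
    (∃ u, IsOverlap u ∧ u <+: w) ↔
      ∃ p, 0 < p ∧ 2 * p < w.length ∧ ∀ j ≤ p, w.getD j false = w.getD (j + p) false := by
  constructor
  · rintro ⟨u, ⟨a, x, rfl⟩, t, rfl⟩
    refine ⟨x.length + 1, by omega, by simp; omega, fun j hj => ?_⟩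
    have h : [a] ++ x ++ [a] ++ x ++ [a] ++ t = (a :: x) ++ ((a :: x) ++ (a :: t)) := by simp
    rw [h, List.getD_append_right _ _ _ (j + (x.length + 1)) (by simp)]
    rcases Nat.lt_or_ge j (x.length + 1) with hlt | hge
    · rw [List.getD_append _ _ _ j (by simpa using hlt),
        List.getD_append _ _ _ _ (by simpa using hlt)]
      simp
    · have : j = x.length + 1 := by omega
      subst this
      simp [List.getD_eq_getElem?_getD]
  · rintro ⟨p, hp, hlen, h⟩
    obtain ⟨q, rfl⟩ : ∃ q, p = q + 1 := ⟨p - 1, by omega⟩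
    cases w with
    | nil => simp at hlen
    | cons a w =>
      refine ⟨_, ⟨a, w.take q, rfl⟩, ?_⟩
      rw [List.prefix_iff_eq_take]
      simp only [List.length_cons] at hlen
      apply List.ext_getElem
      · simp; omega
      · intro i h1 h2
        have key : ∀ j ≤ q + 1, ∀ h1 : j < (a :: w).length, ∀ h2 : j + (q + 1) < (a :: w).length,
            (a :: w)[j] = (a :: w)[j + (q + 1)] := by
          intro j hj h1 h2
          have := h j hj
          rwa [List.getD_eq_getElem _ _ h1, List.getD_eq_getElem _ _ h2] at this
        simp only [List.length_append, List.length_cons, List.length_nil, List.length_take] at h1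
        have e : [a] ++ w.take q ++ [a] ++ w.take q ++ [a]
          = (a :: w).take (q + 1) ++ ((a :: w).take (q + 1) ++ [a]) := by simp
        rw [List.getElem_take]
        simp only [e, List.getElem_append, List.length_take, List.length_cons,
          List.getElem_take]
        split_ifs with c1 c2
        · rfl
        · rw [key _ (by omega) (by simp; omega) (by simp; omega)]
          congr 1
          omega
        · have h0 := key 0 (by omega) (by simp) (by simp; omega)
          have h3 := key (0 + (q + 1)) (by omega) (by simp; omega) (by simp; omega)
          simp only [List.getElem_singleton]
          have : i = 0 + (q + 1) + (q + 1) := by omega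
          subst this
          rw [← h3, ← h0]
          rfl

/-- Overlaps become repetitions of period p on 2p + 1 letters; the bound on s + 2p keeps the default
of `getD` from ever being read. -/
theorem containsOverlap_iff (w : List Bool) :
    ContainsOverlap w ↔ ∃ s p, 0 < p ∧ s + 2 * p < w.length ∧
      ∀ j ≤ p, w.getD (s + j) false = w.getD (s + j + p) false := by
  constructor
  · rintro ⟨u, hu, l, r, rfl⟩
    obtain ⟨p, hp, hlen, h⟩ := (exists_overlap_prefix_iff (u ++ r)).1 ⟨u, hu, r, rfl⟩
    refine ⟨l.length, p, hp, by simp at hlen ⊢; omega, fun j hj => ?_⟩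
    rw [List.append_assoc, List.getD_append_right l _ _ _ (by omega),
      List.getD_append_right l _ _ (l.length + j + p) (by omega)]
    have := h j hj
    rwa [show l.length + j - l.length = j by omega,
      show l.length + j + p - l.length = j + p by omega]
  · rintro ⟨s, p, hp, hlen, h⟩
    obtain ⟨u, hu, hpre⟩ := (exists_overlap_prefix_iff (w.drop s)).2
      ⟨p, hp, by simp; omega, fun j hj => by
        have := h j hj
        simpa [List.getD_eq_getElem?_getD, Nat.add_assoc] using this⟩
    exact ⟨u, hu, hpre.isInfix.trans (List.drop_suffix s w).isInfix⟩

theorem containsOverlap_cons {α : Type*} {a : α} {w : List α} :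
    ContainsOverlap (a :: w) ↔ (∃ u, IsOverlap u ∧ u <+: a :: w) ∨ ContainsOverlap w := by
  simp only [ContainsOverlap, List.infix_cons_iff, and_or_left, exists_or]

theorem ContainsOverlap.mono {α : Type*} {v w : List α} (h : ContainsOverlap v) (hvw : v <:+: w) :
    ContainsOverlap w :=
  let ⟨u, hu, hi⟩ := h
  ⟨u, hu, hi.trans hvw⟩

theorem OverlapFree.anti {α : Type*} {v w : List α} (h : OverlapFree w) (hvw : v <:+: w) :
    OverlapFree v :=
  fun hv => h (hv.mono hvw)

theorem isOverlap_reverse {α : Type*} {u : List α} (h : IsOverlap u) : IsOverlap u.reverse := by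
  obtain ⟨a, x, rfl⟩ := h
  exact ⟨a, x.reverse, by simp⟩

@[simp] theorem containsOverlap_reverse {α : Type*} {w : List α} :
    ContainsOverlap w.reverse ↔ ContainsOverlap w := by
  constructor
  · rintro ⟨u, hu, hi⟩
    exact ⟨_, isOverlap_reverse hu, by simpa using hi.reverse⟩
  · rintro ⟨u, hu, hi⟩
    exact ⟨_, isOverlap_reverse hu, hi.reverse⟩

@[simp] theorem overlapFree_reverse {α : Type*} {w : List α} :
    OverlapFree w.reverse ↔ OverlapFree w :=
  not_congr containsOverlap_reverse

theorem ContainsOverlap.map {α β : Type*} (f : α → β) {w : List α} (h : ContainsOverlap w) :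
    ContainsOverlap (w.map f) := by
  obtain ⟨_, ⟨a, x, rfl⟩, hi⟩ := h
  exact ⟨_, ⟨f a, x.map f, rfl⟩, by simpa using hi.map f⟩

theorem containsOverlap_map_equiv {α β : Type*} (e : α ≃ β) {w : List α} :
    ContainsOverlap (w.map e) ↔ ContainsOverlap w :=
  ⟨fun h => by simpa using h.map e.symm, fun h => h.map e⟩

/-- The word obtained from `w` by inserting the letter `a` at position `i`. -/
def insertAt {α : Type*} (w : List α) (i : ℕ) (a : α) : List α :=
  w.take i ++ a :: w.drop i

theorem isExtension_iff {α : Type*} {v w : List α} :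
    IsExtension v w ↔ ∃ i ≤ w.length, ∃ a, v = insertAt w i a := by
  constructor
  · rintro ⟨l, r, a, rfl, rfl⟩
    exact ⟨l.length, by simp, a, by simp [insertAt]⟩
  · rintro ⟨i, hi, a, rfl⟩
    exact ⟨w.take i, w.drop i, a, by simp, by simp [insertAt]⟩

theorem IsExtension.reverse {α : Type*} {v w : List α} (h : IsExtension v w) :
    IsExtension v.reverse w.reverse := by
  obtain ⟨l, r, a, rfl, rfl⟩ := h
  exact ⟨r.reverse, l.reverse, a, by simp, by simp⟩

theorem IsExtension.map {α β : Type*} (f : α → β) {v w : List α} (h : IsExtension v w) :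
    IsExtension (v.map f) (w.map f) := by
  obtain ⟨l, r, a, rfl, rfl⟩ := h
  exact ⟨l.map f, r.map f, f a, by simp, by simp⟩

theorem ExtremalOverlapFree.reverse {α : Type*} {w : List α} (h : ExtremalOverlapFree w) :
    ExtremalOverlapFree w.reverse :=
  ⟨overlapFree_reverse.2 h.1, fun v hv => by
    have := h.2 v.reverse (by simpa using hv.reverse)
    simpa using this⟩

theorem ExtremalOverlapFree.map_equiv {α β : Type*} (e : α ≃ β) {w : List α}
    (h : ExtremalOverlapFree w) : ExtremalOverlapFree (w.map e) :=
  ⟨fun ho => h.1 ((containsOverlap_map_equiv e).1 ho), fun v hv => by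
    have := h.2 (v.map e.symm) (by simpa using hv.map e.symm)
    simpa using this.map e⟩

/-- Allows work over `Bool`, where `!` is the complement. -/
theorem exists_extremalOverlapFree_congr {α β : Type*} (e : α ≃ β) (n : ℕ) :
    (∃ w : List α, w.length = n ∧ ExtremalOverlapFree w) ↔
      ∃ w : List β, w.length = n ∧ ExtremalOverlapFree w :=
  ⟨fun ⟨w, hn, h⟩ => ⟨w.map e, by simpa using hn, h.map_equiv e⟩,
    fun ⟨w, hn, h⟩ => ⟨w.map e.symm, by simpa using hn, h.map_equiv e.symm⟩⟩

/-! ### A decision procedure -/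

/-- The first `n` letters of the two words exist and agree. -/
def agreeUpTo : ℕ → List Bool → List Bool → Bool
  | 0, _, _ => true
  | n + 1, a :: u, b :: v => (a == b) && agreeUpTo n u v
  | _ + 1, _, _ => false

theorem agreeUpTo_iff (n : ℕ) (u v : List Bool) :
    agreeUpTo n u v = true ↔
      n ≤ u.length ∧ n ≤ v.length ∧ ∀ j < n, u.getD j false = v.getD j false := by
  induction n generalizing u v with
  | zero => simp [agreeUpTo]
  | succ n ih =>
    cases u with
    | nil => simp [agreeUpTo]
    | cons a u =>
      cases v with
      | nil => simp [agreeUpTo]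
      | cons b v =>
        simp only [agreeUpTo, Bool.and_eq_true, beq_iff_eq, ih, List.length_cons,
          Nat.add_le_add_iff_right]
        constructor
        · rintro ⟨rfl, h1, h2, h3⟩
          refine ⟨h1, h2, fun j hj => ?_⟩
          cases j with
          | zero => simp
          | succ j => simpa using h3 j (by omega)
        · rintro ⟨h1, h2, h3⟩
          exact ⟨by simpa using h3 0 (by omega), h1, h2, fun j hj => by
            simpa using h3 (j + 1) (by omega)⟩

/-- Some prefix of the word is an overlap. -/
def overlapPrefixed (w : List Bool) : Bool :=
  -- The period tested is p + 1, so p + 2 letters must agree with their translates.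
  (List.range w.length).any fun p => agreeUpTo (p + 2) w (w.drop (p + 1))

theorem overlapPrefixed_iff (w : List Bool) :
    overlapPrefixed w = true ↔ ∃ u, IsOverlap u ∧ u <+: w := by
  simp only [overlapPrefixed, List.any_eq_true, List.mem_range, agreeUpTo_iff,
    exists_overlap_prefix_iff, List.length_drop]
  constructor
  · rintro ⟨p, hp, h1, h2, h3⟩
    refine ⟨p + 1, by omega, by omega, fun j hj => ?_⟩
    have := h3 j (by omega)
    simpa [List.getD_eq_getElem?_getD, Nat.add_comm, Nat.add_left_comm] using this
  · rintro ⟨p, hp, h1, h2⟩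
    refine ⟨p - 1, by omega, by omega, by omega, fun j hj => ?_⟩
    have := h2 j (by omega)
    rw [this, show p - 1 + 1 = p by omega]
    simp [List.getD_eq_getElem?_getD, Nat.add_comm]

/-- Some factor of the word is an overlap. -/
def hasOverlap : List Bool → Bool
  | [] => false
  | a :: w => overlapPrefixed (a :: w) || hasOverlap w

theorem hasOverlap_iff (w : List Bool) : hasOverlap w = true ↔ ContainsOverlap w := by
  induction w with
  | nil =>
    simp only [hasOverlap, Bool.false_eq_true, false_iff]
    rintro ⟨_, ⟨a, x, rfl⟩, hi⟩
    simp at hi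
  | cons a w ih =>
    rw [hasOverlap, Bool.or_eq_true, overlapPrefixed_iff, ih, containsOverlap_cons]

instance decidableContainsOverlap (w : List Bool) : Decidable (ContainsOverlap w) :=
  decidable_of_iff _ (hasOverlap_iff w)

instance decidableOverlapFree (w : List Bool) : Decidable (OverlapFree w) :=
  inferInstanceAs (Decidable (¬ ContainsOverlap w))

/-! ### The Thue–Morse morphism -/

/-- The Thue–Morse morphism `0 ↦ 01`, `1 ↦ 10`. -/
def mu : List Bool → List Bool
  | [] => []
  | a :: l => a :: (!a) :: mu l

@[simp] theorem mu_nil : mu [] = [] := rfl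

@[simp] theorem mu_cons (a : Bool) (l : List Bool) : mu (a :: l) = a :: (!a) :: mu l := rfl

@[simp] theorem mu_append (l r : List Bool) : mu (l ++ r) = mu l ++ mu r := by
  induction l with
  | nil => rfl
  | cons a l ih => simp [ih]

@[simp] theorem length_mu (l : List Bool) : (mu l).length = 2 * l.length := by
  induction l with
  | nil => rfl
  | cons a l ih => simp [ih]; omega

theorem getD_mu_even (l : List Bool) (k : ℕ) : (mu l).getD (2 * k) false = l.getD k false := by
  induction l generalizing k with
  | nil => simp
  | cons a l ih =>
    cases k with
    | zero => simp
    | succ k => simpa [Nat.mul_add] using ih k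

/-- Unlike the even case this needs the bound: past the end both defaults are `false`. -/
theorem getD_mu_odd (l : List Bool) (k : ℕ) (hk : k < l.length) :
    (mu l).getD (2 * k + 1) false = !(l.getD k false) := by
  induction l generalizing k with
  | nil => simp at hk
  | cons a l ih =>
    cases k with
    | zero => simp
    | succ k => simpa [Nat.mul_add] using ih k (by simpa using hk)

theorem mu_reverse (l : List Bool) : (mu l).reverse = mu (l.reverse.map not) := by
  induction l with
  | nil => rfl
  | cons a l ih => simp [ih]

theorem mu_map_not (l : List Bool) : mu (l.map not) = (mu l).map not := by
  induction l with
  | nil => rfl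
  | cons a l ih => simp [ih]

theorem mu_prefix {l r : List Bool} (h : l <+: r) : mu l <+: mu r := by
  obtain ⟨t, rfl⟩ := h
  simp

/-- An even period halves. An odd one is impossible: of two adjacent positions and their translates
by p, one pair is a block of `mu`, so f alternates along the first p + 1 letters, and then its
values at s and s + p differ. -/
theorem exists_overlap_half {f g : ℕ → Bool} {n s p : ℕ}
    (hf : ∀ k < n, f (2 * k) = g k ∧ f (2 * k + 1) = !g k) (hp : 0 < p) (hs : s + 2 * p < 2 * n)
    (h : ∀ j ≤ p, f (s + j) = f (s + j + p)) :
    ∃ s' q, 0 < q ∧ s' + 2 * q < n ∧ ∀ j ≤ q, g (s' + j) = g (s' + j + q) := by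
  rcases Nat.even_or_odd' p with ⟨q, rfl | rfl⟩
  · refine ⟨s / 2, q, by omega, by omega, fun j hj => ?_⟩
    have hj' := h (2 * j) (by omega)
    rcases Nat.even_or_odd' s with ⟨t, rfl | rfl⟩
    · rw [show 2 * t + 2 * j + 2 * q = 2 * (t + j + q) by ring,
        show 2 * t + 2 * j = 2 * (t + j) by ring, (hf _ (by omega)).1, (hf _ (by omega)).1] at hj'
      rwa [show 2 * t / 2 = t by omega]
    · rw [show 2 * t + 1 + 2 * j + 2 * q = 2 * (t + j + q) + 1 by ring,
        show 2 * t + 1 + 2 * j = 2 * (t + j) + 1 by ring, (hf _ (by omega)).2,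
        (hf _ (by omega)).2] at hj'
      rw [show (2 * t + 1) / 2 = t by omega]
      simpa using hj'
  · exfalso
    have step : ∀ j < 2 * q + 1, f (s + (j + 1)) = !f (s + j) := by
      intro j hj
      rcases Nat.even_or_odd' (s + j) with ⟨t, ht | ht⟩
      · rw [show s + (j + 1) = 2 * t + 1 by omega, ht, (hf _ (by omega)).1, (hf _ (by omega)).2]
      · rw [h j (by omega), h (j + 1) (by omega),
          show s + (j + 1) + (2 * q + 1) = 2 * (t + q + 1) + 1 by omega,
          show s + j + (2 * q + 1) = 2 * (t + q + 1) by omega, (hf _ (by omega)).1,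
          (hf _ (by omega)).2]
    have alt : ∀ i ≤ q, f (s + 2 * i) = f s := by
      intro i
      induction i with
      | zero => simp
      | succ i ih =>
        intro hi
        rw [show s + 2 * (i + 1) = s + (2 * i + 1 + 1) by ring, step _ (by omega),
          step _ (by omega), Bool.not_not]
        exact ih (by omega)
    have h0 := h 0 (by omega)
    rw [show s + 0 + (2 * q + 1) = s + (2 * q + 1) by ring, step _ (by omega), alt q le_rfl] at h0
    simp at h0

theorem overlapFree_mu {y : List Bool} (h : OverlapFree y) : OverlapFree (mu y) := by
  intro ho
  obtain ⟨s, p, hp, hs, hj⟩ := (containsOverlap_iff _).1 ho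
  refine h ((containsOverlap_iff _).2 ?_)
  rw [length_mu] at hs
  exact exists_overlap_half (f := fun i => (mu y).getD i false)
    (g := fun i => y.getD i false)
    (fun k hk => ⟨getD_mu_even y k, getD_mu_odd y k hk⟩) hp hs hj

theorem overlapFree_mu_iterate {y : List Bool} (h : OverlapFree y) (k : ℕ) :
    OverlapFree (mu^[k] y) := by
  induction k with
  | zero => exact h
  | succ k ih => rw [Function.iterate_succ_apply']; exact overlapFree_mu ih

/-- An overlap of `y` becomes a factor of period `2 * q` of `mu y` that is one letter longer than
an overlap, so that one letter may be lost at either of its ends. -/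
theorem getD_mu_period {y : List Bool} {s q : ℕ} (hs : s + 2 * q < y.length)
    (h : ∀ j ≤ q, y.getD (s + j) false = y.getD (s + j + q) false) :
    ∀ j ≤ 2 * q + 1, (mu y).getD (2 * s + j) false = (mu y).getD (2 * s + j + 2 * q) false := by
  intro j hj
  rcases Nat.even_or_odd' j with ⟨i, rfl | rfl⟩
  · rw [show 2 * s + 2 * i + 2 * q = 2 * (s + i + q) by ring,
      show 2 * s + 2 * i = 2 * (s + i) by ring, getD_mu_even, getD_mu_even, h i (by omega)]
  · rw [show 2 * s + (2 * i + 1) + 2 * q = 2 * (s + i + q) + 1 by ring,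
      show 2 * s + (2 * i + 1) = 2 * (s + i) + 1 by ring, getD_mu_odd _ _ (by omega),
      getD_mu_odd _ _ (by omega), h i (by omega)]

theorem containsOverlap_of_shift {v w : List Bool} {d s p : ℕ} (hp : 0 < p)
    (hd : ∀ i < v.length, v.getD i false = w.getD (i + d) false) (hds : d ≤ s)
    (hs : s + 2 * p < v.length + d)
    (h : ∀ j ≤ p, w.getD (s + j) false = w.getD (s + j + p) false) : ContainsOverlap v := by
  refine (containsOverlap_iff _).2 ⟨s - d, p, hp, by omega, fun j hj => ?_⟩
  rw [hd _ (by omega), hd _ (by omega), show s - d + j + d = s + j by omega,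
    show s - d + j + p + d = s + j + p by omega]
  exact h j hj

/-- If `a :: mu v` is overlap-free then so is `!a :: v`. -/
theorem overlapFree_of_cons_mu {a : Bool} {v : List Bool} (h : OverlapFree (a :: mu v)) :
    OverlapFree ((!a) :: v) := by
  intro ho
  obtain ⟨s, q, hq, hs, hj⟩ := (containsOverlap_iff _).1 ho
  refine h (containsOverlap_of_shift (w := mu ((!a) :: v)) (d := 1) (s := 2 * s + 1) (p := 2 * q)
    (by omega) (fun i _ => by simp) (by omega) (by simp at hs ⊢; omega) fun j hj' => ?_)
  have := getD_mu_period hs hj (j + 1) (by omega)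
  rwa [show 2 * s + 1 + j = 2 * s + (j + 1) by ring]

theorem overlapFree_of_mu {v : List Bool} (h : OverlapFree (mu v)) : OverlapFree v := by
  intro ho
  obtain ⟨s, q, hq, hs, hj⟩ := (containsOverlap_iff _).1 ho
  refine h ((containsOverlap_iff _).2 ⟨2 * s, 2 * q, by omega, by simp; omega, fun j hj' => ?_⟩)
  exact getD_mu_period hs hj j (by omega)

/-- Mirror image of `overlapFree_of_cons_mu`, since reversing a `mu`-image complements the preimage.
-/
theorem overlapFree_of_mu_append {d : Bool} {v : List Bool} (h : OverlapFree (mu v ++ [d])) :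
    OverlapFree (v ++ [d]) := by
  rw [← overlapFree_reverse] at h ⊢
  rw [List.reverse_append, mu_reverse] at h
  have := overlapFree_of_cons_mu h
  intro ho
  apply this
  have := ho.map not
  simpa using this

/-! ### Factorization of overlap-free words -/

/-- A word of length at most two that is not a product of two distinct letters. -/
def IsMargin (x : List Bool) : Prop :=
  x = [] ∨ (∃ a, x = [a]) ∨ ∃ a, x = [a, a]

theorem isMargin_nil : IsMargin [] := Or.inl rfl

theorem isMargin_one (a : Bool) : IsMargin [a] := Or.inr (Or.inl ⟨a, rfl⟩)

theorem isMargin_two (a : Bool) : IsMargin [a, a] := Or.inr (Or.inr ⟨a, rfl⟩)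

theorem exists_factorization {w : List Bool} (h : OverlapFree w) :
    ∃ x y z, IsMargin x ∧ IsMargin z ∧ w = x ++ mu y ++ z := by
  induction w using List.reverseRecOn with
  | nil => exact ⟨[], [], [], isMargin_nil, isMargin_nil, rfl⟩
  | append_singleton w c ih =>
    obtain ⟨x, y, z, hx, hz, rfl⟩ := ih (h.anti (List.prefix_append _ _).isInfix)
    clear ih
    rcases hz with rfl | ⟨d, rfl⟩ | ⟨d, rfl⟩
    · exact ⟨x, y, [c], hx, isMargin_one c, by simp⟩
    · by_cases hcd : c = d
      · subst hcd
        exact ⟨x, y, [c, c], hx, isMargin_two c, by simp⟩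
      · refine ⟨x, y ++ [d], [], hx, isMargin_nil, ?_⟩
        have : c = !d := Bool.eq_not_of_ne hcd
        simp [this]
    -- The new letter forms a block with the second d, so the blocks must be regrouped with the
    -- other phase. This works while y has at most one letter; with two letters an overlap is
    -- already present.
    · have hc : c = !d := by
        by_contra hcd
        have : c = d := by simpa using hcd
        subst this
        refine h (ContainsOverlap.mono (v := [c, c, c]) ((by decide : ∀ c : Bool, ContainsOverlap [c, c, c]) c) ?_)
        exact List.IsSuffix.isInfix ⟨x ++ mu y, by simp⟩
      subst hc
      rcases List.eq_nil_or_concat y with rfl | ⟨y, e, rfl⟩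
      · rcases hx with rfl | ⟨a, rfl⟩ | ⟨a, rfl⟩
        · exact ⟨[d], [d], [], isMargin_one d, isMargin_nil, by simp⟩
        · refine ⟨[], [a, d], [], isMargin_nil, isMargin_nil, ?_⟩
          revert h; revert a d; decide
        · refine ⟨[a], [a, d], [], isMargin_one a, isMargin_nil, ?_⟩
          revert h; revert a d; decide
      · rcases List.eq_nil_or_concat y with rfl | ⟨y, f, rfl⟩
        · rcases hx with rfl | ⟨a, rfl⟩ | ⟨a, rfl⟩
          · refine ⟨[d], [!d, d], [], isMargin_one d, isMargin_nil, ?_⟩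
            revert h; revert e d; decide
          · by_cases had : a = d
            · refine ⟨[a, a], [!d, d], [], isMargin_two a, isMargin_nil, ?_⟩
              revert had h; revert a e d; decide
            · refine ⟨[], [a, a, d], [], isMargin_nil, isMargin_nil, ?_⟩
              revert had h; revert a e d; decide
          · refine ⟨[a], [a, !d, d], [], isMargin_one a, isMargin_nil, ?_⟩
            revert h; revert a e d; decide
        · exfalso
          refine h (ContainsOverlap.mono (v := [f, !f, e, !e, d, d, !d])
            ((by decide : ∀ d e f : Bool, ContainsOverlap [f, !f, e, !e, d, d, !d]) d e f) ?_)
          exact List.IsSuffix.isInfix ⟨x ++ mu y, by simp⟩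

theorem IsMargin.length_le {x : List Bool} (h : IsMargin x) : x.length ≤ 2 := by
  rcases h with rfl | ⟨a, rfl⟩ | ⟨a, rfl⟩ <;> simp

theorem getD_factorization {x y z : List Bool} {k : ℕ} (hk : k < y.length) :
    (x ++ mu y ++ z).getD (x.length + 2 * k) false = y.getD k false ∧
      (x ++ mu y ++ z).getD (x.length + 2 * k + 1) false = !y.getD k false := by
  have key : ∀ i < 2 * y.length, (x ++ mu y ++ z).getD (x.length + i) false
      = (mu y).getD i false := by
    intro i hi
    rw [List.append_assoc, List.getD_append_right x _ _ _ (by omega),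
      List.getD_append _ _ _ _ (by simp; omega)]
    congr 1
    omega
  rw [Nat.add_assoc, key _ (by omega), key _ (by omega)]
  exact ⟨getD_mu_even y k, getD_mu_odd y k hk⟩

/-- Inside an overlap-free word, squares of letters occur only at positions of one parity. -/
theorem exists_parity_of_eq_succ {w : List Bool} (h : OverlapFree w) :
    ∃ e, ∀ i, 1 ≤ i → i + 3 ≤ w.length → w.getD i false = w.getD (i + 1) false → i % 2 = e := by
  obtain ⟨x, y, z, hx, hz, rfl⟩ := exists_factorization h
  refine ⟨(x.length + 1) % 2, fun i h1 h2 heq => ?_⟩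
  by_contra hne
  have hx' := hx.length_le
  have hz' := hz.length_le
  simp only [List.length_append, length_mu] at h2
  obtain ⟨k, hk⟩ : ∃ k, i = x.length + 2 * k := ⟨(i - x.length) / 2, by omega⟩
  subst hk
  have := getD_factorization (x := x) (z := z) (show k < y.length by omega)
  rw [this.1, this.2] at heq
  simp at heq

/-- Among five consecutive letters of an overlap-free word, two consecutive ones are equal. -/
theorem exists_eq_succ {w : List Bool} (h : OverlapFree w) {s : ℕ} (hs : s + 5 ≤ w.length) :
    ∃ i, s ≤ i ∧ i < s + 4 ∧ w.getD i false = w.getD (i + 1) false := by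
  by_contra! hne
  have key : ∀ i, s ≤ i → i < s + 4 → w.getD (i + 1) false = !w.getD i false := fun i h1 h2 =>
    Bool.eq_not_of_ne (Ne.symm (hne i h1 h2))
  refine h ((containsOverlap_iff _).2 ⟨s, 2, by omega, by omega, fun j hj => ?_⟩)
  rw [show s + j + 2 = s + j + 1 + 1 by ring, key _ (by omega) (by omega),
    key _ (by omega) (by omega), Bool.not_not]

/-! ### Squares -/

theorem containsOverlap_square_five :
    ∀ a b c d e : Bool, ContainsOverlap [a, b, c, d, e, a, b, c, d, e] := by
  decide

/-- An even period is halved by desubstitution, after moving one letter across when both margins are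
single letters. An odd period of at least 7 would carry an interior pair of equal letters to a
position of the other parity; period 5 is checked by hand. -/
theorem square_period {r : ℕ} (hr : 0 < r) {w : List Bool} (h : OverlapFree w)
    (hlen : w.length = 2 * r) (hsq : ∀ j < r, w.getD j false = w.getD (j + r) false) :
    ∃ k, r = 2 ^ k ∨ r = 3 * 2 ^ k := by
  induction r using Nat.strong_induction_on generalizing w with
  | _ r ih =>
  rcases Nat.even_or_odd' r with ⟨q, rfl | rfl⟩
  · rcases Nat.lt_or_ge q 2 with hq | hq
    · exact ⟨1, by omega⟩
    suffices ∃ y, OverlapFree y ∧ y.length = 2 * q ∧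
        ∀ j < q, y.getD j false = y.getD (j + q) false by
      obtain ⟨y, hy, hyl, hyq⟩ := this
      obtain ⟨k, hk⟩ := ih q (by omega) (by omega) hy hyl hyq
      exact ⟨k + 1, by rw [pow_succ]; omega⟩
    obtain ⟨x, y, z, hx, hz, rfl⟩ := exists_factorization h
    have hx' := hx.length_le
    have hz' := hz.length_le
    have hl := hlen
    simp only [List.length_append, length_mu] at hl
    have hD := fun k hk => getD_factorization (x := x) (y := y) (z := z) (k := k) hk
    rcases hx with rfl | ⟨a, rfl⟩ | ⟨a, rfl⟩
    · rcases hz with rfl | ⟨b, rfl⟩ | ⟨b, rfl⟩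
      · simp only [List.length_nil] at hl hD
        refine ⟨y, overlapFree_of_mu (by simpa using h), by omega, fun j hj => ?_⟩
        rw [← (hD j (by omega)).1, ← (hD (j + q) (by omega)).1, hsq _ (by omega)]
        congr 1
        ring
      · simp only [List.length_nil, List.length_singleton] at hl
        omega
      · exfalso
        simp only [List.length_nil, List.length_cons] at hl hD
        have hz : ∀ i < 2, ([] ++ mu y ++ [b, b]).getD (2 * y.length + i) false = b := by
          intro i hi
          rw [List.getD_append_right _ _ _ _ (by simp)]
          interval_cases i <;> simp
        have h0 := hsq (2 * q - 2) (by omega)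
        have h1 := hsq (2 * q - 1) (by omega)
        rw [show 2 * q - 2 + 2 * q = 2 * y.length + 0 by omega, hz _ (by omega),
          show 2 * q - 2 = 0 + 2 * (q - 1) by omega, (hD _ (by omega)).1] at h0
        rw [show 2 * q - 1 + 2 * q = 2 * y.length + 1 by omega, hz _ (by omega),
          show 2 * q - 1 = 0 + 2 * (q - 1) + 1 by omega, (hD _ (by omega)).2, h0] at h1
        simp at h1
    · rcases hz with rfl | ⟨b, rfl⟩ | ⟨b, rfl⟩
      · simp only [List.length_nil, List.length_singleton] at hl
        omega
      · simp only [List.length_singleton] at hl hD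
        have hlast : ([a] ++ mu y ++ [b]).getD (2 * q - 1 + 2 * q) false = b := by
          rw [List.getD_append_right _ _ _ _ (by simp; omega)]
          simp [show 2 * q - 1 + 2 * q = 2 * y.length + 1 by omega]
        have hb : y.getD (q - 1) false = b := by
          have h1 := hsq (2 * q - 1) (by omega)
          rwa [hlast, show 2 * q - 1 = 1 + 2 * (q - 1) by omega, (hD _ (by omega)).1] at h1
        have ha : a = !b := by
          rw [← hb, ← (hD (q - 1) (by omega)).2]
          have := hsq 0 (by omega)
          rw [show 1 + 2 * (q - 1) + 1 = 0 + 2 * q by omega, ← this]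
          simp
        -- Moving the last letter b = !a to the front turns the word into mu((!a) :: y), again a
        -- square.
        refine ⟨(!a) :: y, overlapFree_of_cons_mu (h.anti ⟨[], [b], by simp⟩), by simp; omega,
          fun j hj => ?_⟩
        cases j with
        | zero =>
          rw [show 0 + q = q - 1 + 1 by omega, List.getD_cons_zero, List.getD_cons_succ, hb, ha,
            Bool.not_not]
        | succ j =>
          rw [show j + 1 + q = j + q + 1 by omega, List.getD_cons_succ, List.getD_cons_succ,
            ← (hD j (by omega)).1, ← (hD (j + q) (by omega)).1, hsq _ (by omega)]
          congr 1
          omega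
      · simp only [List.length_cons, List.length_nil] at hl
        omega
    · exfalso
      simp only [List.length_cons, List.length_nil] at hl hD
      have h0 := hsq 0 (by omega)
      have h1 := hsq 1 (by omega)
      rw [show 0 + 2 * q = 0 + 1 + 1 + 2 * (q - 1) by omega, (hD _ (by omega)).1] at h0
      rw [show 1 + 2 * q = 0 + 1 + 1 + 2 * (q - 1) + 1 by omega, (hD _ (by omega)).2, ← h0] at h1
      simp at h1
  · rcases Nat.lt_or_ge q 2 with hq | hq
    · exact ⟨0, by omega⟩
    exfalso
    rcases Nat.eq_or_lt_of_le hq with rfl | hq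
    · refine h ?_
      have : ∃ a b c d e, w = [a, b, c, d, e, a, b, c, d, e] := by
        refine ⟨w.getD 0 false, w.getD 1 false, w.getD 2 false, w.getD 3 false, w.getD 4 false, ?_⟩
        apply List.ext_getElem (by simpa using hlen)
        intro i h1 h2
        rw [← List.getD_eq_getElem _ false h1]
        have := hsq (i - 5) (by omega)
        simp only [List.length_cons, List.length_nil] at h2
        interval_cases i <;> first | rfl | exact this.symm
      obtain ⟨a, b, c, d, e, rfl⟩ := this
      exact containsOverlap_square_five a b c d e
    · obtain ⟨e, he⟩ := exists_parity_of_eq_succ h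
      obtain ⟨i, hi1, hi2, hi⟩ := exists_eq_succ h (s := 1) (by omega)
      have h1 := he i hi1 (by omega) hi
      have h2 := he (i + (2 * q + 1)) (by omega) (by omega) (by
        rw [← hsq i (by omega), hi, hsq (i + 1) (by omega)]
        congr 1
        ring)
      omega

/-! ### The possible odd lengths -/

theorem length_of_cons_cons_mu_append {a d : Bool} {y : List Bool}
    (h : ExtremalOverlapFree ([a, a] ++ mu y ++ [d])) :
    ∃ r, 0 < r ∧ 2 * y.length + 3 = 4 * r + 1 ∧ ∃ k, r = 2 ^ k ∨ r = 3 * 2 ^ k := by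
  have hext := h.2 ([a, a] ++ mu y ++ [d, !d])
    ⟨[a, a] ++ mu y ++ [d], [], !d, by simp, by simp⟩
  have hof : OverlapFree (mu ((!a) :: (y ++ [d]))) → False := by
    intro hf
    rw [show [a, a] ++ mu y ++ [d, !d] = a :: a :: mu (y ++ [d]) by simp,
      containsOverlap_cons] at hext
    rcases hext with ⟨u, hu, hpre⟩ | hc
    · have hlen : u.length ≤ (a :: a :: mu (y ++ [d])).length := hpre.length_le
      have hodd : u.length % 2 = 1 := by
        obtain ⟨c, x, rfl⟩ := hu
        simp; omega
      refine h.1 ⟨u, hu, List.IsPrefix.isInfix ?_⟩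
      refine List.prefix_of_prefix_length_le hpre (l₂ := [a, a] ++ mu y ++ [d])
        ⟨[!d], by simp⟩ ?_
      simp at hlen ⊢
      omega
    · exact (hf.anti ⟨[!a], [], by simp⟩) hc
  have hy : ContainsOverlap ((!a) :: (y ++ [d])) := by
    by_contra hno
    exact hof (overlapFree_mu hno)
  obtain ⟨s, q, hq, hs, hj⟩ := (containsOverlap_iff _).1 hy
  have hper := getD_mu_period hs hj
  have hsh : ∀ i < ([a] ++ mu y ++ [d]).length, ([a] ++ mu y ++ [d]).getD i false
      = (mu ((!a) :: (y ++ [d]))).getD (i + 1) false := by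
    intro i hi
    have : mu ((!a) :: (y ++ [d])) = [!a] ++ (([a] ++ mu y ++ [d]) ++ [!d]) := by simp
    rw [this, List.getD_append_right [!a] _ _ _ (by simp), List.length_singleton,
      Nat.add_sub_cancel, List.getD_append _ [!d] _ _ hi]
  have hfree : OverlapFree ([a] ++ mu y ++ [d]) := h.1.anti ⟨[a], [], by simp⟩
  simp only [List.length_cons, List.length_append, List.length_nil] at hs
  by_cases hwhole : s = 0 ∧ 2 * q + 1 = y.length + 2
  · obtain ⟨rfl, hw⟩ := hwhole
    refine ⟨q, hq, by omega, square_period hq (w := (!a) :: y) ?_ (by simp; omega) ?_⟩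
    · exact overlapFree_of_cons_mu (hfree.anti ⟨[], [d], by simp⟩)
    -- An overlap without its last letter is a square.
    · intro j hj'
      have := hj j (by omega)
      rw [Nat.zero_add, ← List.cons_append, List.getD_append _ _ _ _ (by simp; omega),
        List.getD_append _ _ _ _ (by simp; omega)] at this
      exact this
  -- If the overlap misses an end of (!a) :: (y ++ [d]), its image loses at most one letter in `[a]
  -- ++ mu y ++ [d]`, and `getD_mu_period` has one letter to spare.
  · exfalso
    apply hfree
    rcases Nat.eq_zero_or_pos s with rfl | hpos
    · refine containsOverlap_of_shift (p := 2 * q) (s := 1) (by omega) hsh le_rfl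
        (by simp; omega) fun j hj' => ?_
      have := hper (j + 1) (by omega)
      rwa [show 1 + j = 2 * 0 + (j + 1) by ring]
    · exact containsOverlap_of_shift (p := 2 * q) (s := 2 * s) (by omega) hsh (by omega)
        (by simp; omega) fun j hj' => hper j (by omega)

/-- Appending !d completes the last block and gives mu(y ++ [d]). -/
theorem not_extremal_mu_append {d : Bool} {y : List Bool} :
    ¬ ExtremalOverlapFree (mu y ++ [d]) := fun h => by
  refine overlapFree_mu (overlapFree_of_mu_append h.1) ?_
  exact h.2 _ ⟨mu y ++ [d], [], !d, by simp, by simp⟩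

theorem ExtremalOverlapFree.length_of_odd {w : List Bool} (h : ExtremalOverlapFree w)
    (hodd : w.length % 2 = 1) :
    ∃ r, 0 < r ∧ w.length = 4 * r + 1 ∧ ∃ k, r = 2 ^ k ∨ r = 3 * 2 ^ k := by
  obtain ⟨x, y, z, hx, hz, rfl⟩ := exists_factorization h.1
  have hrev := h.reverse
  simp only [List.length_append, length_mu, List.reverse_append, mu_reverse] at hodd hrev ⊢
  rcases hz with rfl | ⟨b, rfl⟩ | ⟨b, rfl⟩
  · rcases hx with rfl | ⟨a, rfl⟩ | ⟨a, rfl⟩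
    · simp at hodd
    · exact (not_extremal_mu_append (by simpa using hrev)).elim
    · simp at hodd
  · rcases hx with rfl | ⟨a, rfl⟩ | ⟨a, rfl⟩
    · exact (not_extremal_mu_append (by simpa using h)).elim
    · simp at hodd; omega
    · obtain ⟨r, hr, hl, hk⟩ := length_of_cons_cons_mu_append h
      exact ⟨r, hr, by simp; omega, hk⟩
  · rcases hx with rfl | ⟨a, rfl⟩ | ⟨a, rfl⟩
    · simp at hodd
    · obtain ⟨r, hr, hl, hk⟩ := length_of_cons_cons_mu_append (by simpa using hrev)
      exact ⟨r, hr, by simp at hl ⊢; omega, hk⟩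
    · simp at hodd

/-! ### A criterion for extremality -/

theorem insertAt_reverse {α : Type*} (w : List α) (i : ℕ) (a : α) :
    insertAt w.reverse i a = (insertAt w (w.length - i) a).reverse := by
  simp [insertAt, List.take_reverse, List.drop_reverse]

theorem getD_insertAt_lt {w : List Bool} {i j : ℕ} {a : Bool} (hi : i ≤ w.length) (hj : j < i) :
    (insertAt w i a).getD j false = w.getD j false := by
  rw [insertAt, List.getD_append _ _ _ _ (by simp; omega)]
  simp [List.getD_eq_getElem?_getD, hj]

theorem getD_insertAt_ge {w : List Bool} {i j : ℕ} {a : Bool} (hi : i ≤ w.length) (hj : i ≤ j) :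
    (insertAt w i a).getD (j + 1) false = w.getD j false := by
  rw [insertAt, List.getD_append_right _ _ _ _ (by simp; omega)]
  simp only [List.length_take, min_eq_left hi]
  rw [show j + 1 - i = j - i + 1 by omega, List.getD_cons_succ]
  simp [List.getD_eq_getElem?_getD, Nat.add_sub_cancel' hj]

theorem length_insertAt {α : Type*} (w : List α) (i : ℕ) (a : α) :
    (insertAt w i a).length = w.length + 1 := by
  simp [insertAt]; omega

/-- Each side of position i contains a pair of equal adjacent letters. The insertion moves only the
right one by one place, so the parity condition cannot hold both before and after. -/
theorem containsOverlap_insertAt {w : List Bool} (h : OverlapFree w) {i : ℕ} (a : Bool)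
    (h1 : 6 ≤ i) (h2 : i + 6 ≤ w.length) : ContainsOverlap (insertAt w i a) := by
  by_contra hno
  obtain ⟨e, he⟩ := exists_parity_of_eq_succ h
  obtain ⟨e', he'⟩ := exists_parity_of_eq_succ hno
  rw [length_insertAt] at he'
  obtain ⟨j, hj1, hj2, hj⟩ := exists_eq_succ h (s := 1) (by omega)
  obtain ⟨k, hk1, hk2, hk⟩ := exists_eq_succ h (s := w.length - 6) (by omega)
  have e1 := he j hj1 (by omega) hj
  have e2 := he k (by omega) (by omega) hk
  have e3 := he' j hj1 (by omega) (by
    rw [getD_insertAt_lt (by omega) (by omega), getD_insertAt_lt (by omega) (by omega), hj])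
  have e4 := he' (k + 1) (by omega) (by omega) (by
    rw [getD_insertAt_ge (by omega) (by omega), getD_insertAt_ge (by omega) (by omega), hk])
  omega

theorem extremalOverlapFree_of_ends {w : List Bool} (h : OverlapFree w) (hlen : 12 ≤ w.length)
    (hl : ∀ i ≤ 5, ∀ a, ContainsOverlap (insertAt w i a))
    (hr : ∀ i ≤ 5, ∀ a, ContainsOverlap (insertAt w.reverse i a)) : ExtremalOverlapFree w := by
  refine ⟨h, fun v hv => ?_⟩
  obtain ⟨i, hi, a, rfl⟩ := isExtension_iff.1 hv
  rcases Nat.lt_or_ge i 6 with h6 | h6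
  · exact hl i (by omega) a
  rcases Nat.lt_or_ge (i + 5) w.length with h7 | h7
  · exact containsOverlap_insertAt h a h6 (by omega)
  · have := hr (w.length - i) (by omega) a
    rwa [insertAt_reverse, containsOverlap_reverse,
      show w.length - (w.length - i) = i by omega] at this

theorem containsOverlap_insertAt_of_prefix {p w : List Bool} (hp : p <+: w) {i : ℕ} {a : Bool}
    (hi : i ≤ p.length) (h : ContainsOverlap (insertAt p i a)) :
    ContainsOverlap (insertAt w i a) := by
  obtain ⟨t, rfl⟩ := hp
  refine h.mono ⟨[], t, ?_⟩
  simp [insertAt, List.take_append_of_le_length hi, List.drop_append_of_le_length hi]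

/-! ### Short words -/

/-- All overlap-free words of length `n`. -/
def overlapFreeWords : ℕ → List (List Bool)
  | 0 => [[]]
  | n + 1 => (overlapFreeWords n).flatMap fun w =>
      [false :: w, true :: w].filter fun v => !overlapPrefixed v

theorem mem_overlapFreeWords {w : List Bool} (h : OverlapFree w) :
    w ∈ overlapFreeWords w.length := by
  induction w with
  | nil => simp [overlapFreeWords]
  | cons a w ih =>
    have hw := ih (h.anti (List.suffix_cons a w).isInfix)
    simp only [List.length_cons, overlapFreeWords, List.mem_flatMap]
    refine ⟨w, hw, ?_⟩
    have hp : overlapPrefixed (a :: w) = false := by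
      rw [Bool.eq_false_iff, Ne, overlapPrefixed_iff]
      exact fun hu => h (containsOverlap_cons.2 (Or.inl hu))
    cases a <;> simp [hp]

/-- Some letter can be put in front of the word without creating an overlap at its start. -/
def prependable (w : List Bool) : Bool :=
  !overlapPrefixed (false :: w) || !overlapPrefixed (true :: w)

/-- For overlap-free words: some extension is overlap-free. -/
def extensible (w : List Bool) : Bool :=
  prependable w || prependable w.reverse || (List.range (w.length + 1)).any fun i =>
    !hasOverlap (insertAt w i false) || !hasOverlap (insertAt w i true)

theorem ExtremalOverlapFree.not_prependable {w : List Bool} (h : ExtremalOverlapFree w) :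
    prependable w = false := by
  have key : ∀ a, overlapPrefixed (a :: w) = true := fun a =>
    (overlapPrefixed_iff _).2 ((containsOverlap_cons.1
      (h.2 (a :: w) ⟨[], w, a, rfl, rfl⟩)).resolve_right h.1)
  simp [prependable, key]

theorem ExtremalOverlapFree.not_extensible {w : List Bool} (h : ExtremalOverlapFree w) :
    ¬ extensible w = true := by
  simp only [extensible, h.not_prependable, h.reverse.not_prependable, Bool.false_or,
    List.any_eq_true, List.mem_range, Bool.or_eq_true, Bool.not_eq_true',
    not_exists, not_and, not_or, Bool.not_eq_false, hasOverlap_iff]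
  exact fun i hi => ⟨h.2 _ (isExtension_iff.2 ⟨i, by omega, _, rfl⟩),
    h.2 _ (isExtension_iff.2 ⟨i, by omega, _, rfl⟩)⟩

theorem extensible_of_short :
    ∀ n < 20, n ≠ 10 → n ≠ 12 → ∀ w ∈ overlapFreeWords n, extensible w = true := by
  decide +kernel

theorem ExtremalOverlapFree.length_ge {w : List Bool} (h : ExtremalOverlapFree w) :
    w.length = 10 ∨ w.length = 12 ∨ 20 ≤ w.length := by
  by_contra! hne
  exact h.not_extensible
    (extensible_of_short _ (by omega) hne.1 hne.2.1 w (mem_overlapFreeWords h.1))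

/-! ### Words with prescribed ends -/

/-- A new overlap would be a prefix. Periods up to 6 contradict the first seven letters. A longer
period repeats bbb̄bbb̄ further on, and the letter before this copy completes either bbb or the
overlap b̄bbb̄bbb̄. -/
theorem overlapFree_cons_of_head {b : Bool} {t : List Bool}
    (h : OverlapFree ([b, !b, b, b, !b, !b] ++ t)) :
    OverlapFree (b :: ([b, !b, b, b, !b, !b] ++ t)) := by
  rw [OverlapFree, containsOverlap_cons]
  rintro (hu | hc)
  swap
  · exact h hc
  obtain ⟨p, hp, hlen, hj⟩ := (exists_overlap_prefix_iff _).1 hu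
  set w := b :: ([b, !b, b, b, !b, !b] ++ t) with hw
  have hsh : ∀ i < ([b, !b, b, b, !b, !b] ++ t).length,
      ([b, !b, b, b, !b, !b] ++ t).getD i false = w.getD (i + 1) false := fun i _ => by simp [hw]
  have h0 : w.getD 0 false = b := rfl
  have h1 : w.getD 1 false = b := rfl
  have h2 : w.getD 2 false = !b := rfl
  have h3 : w.getD 3 false = b := rfl
  have h4 : w.getD 4 false = b := rfl
  have h5 : w.getD 5 false = !b := rfl
  have h6 : w.getD 6 false = !b := rfl
  have hwl : w.length = ([b, !b, b, b, !b, !b] ++ t).length + 1 := rfl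
  rcases Nat.lt_or_ge p 7 with h7 | h7
  · interval_cases p
    · exact absurd (h1.symm.trans ((hj 1 (by omega)).trans h2)) (by simp)
    · exact absurd (h0.symm.trans ((hj 0 (by omega)).trans h2)) (by simp)
    · exact absurd (h3.symm.trans ((hj 3 (by omega)).trans h6)) (by simp)
    · exact absurd (h1.symm.trans ((hj 1 (by omega)).trans h5)) (by simp)
    · exact absurd (h0.symm.trans ((hj 0 (by omega)).trans h5)) (by simp)
    · exact absurd (h0.symm.trans ((hj 0 (by omega)).trans h6)) (by simp)
  have g0 := hj 0 (by omega)
  have g1 := hj 1 (by omega)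
  have g2 := hj 2 (by omega)
  have g3 := hj 3 (by omega)
  have g4 := hj 4 (by omega)
  have g5 := hj 5 (by omega)
  obtain ⟨q, rfl⟩ : ∃ q, p = q + 1 := ⟨p - 1, by omega⟩
  apply h
  by_cases hb : w.getD q false = b
  · refine containsOverlap_of_shift (w := w) (d := 1) (s := q) (p := 1) one_pos hsh (by omega)
      (by omega) fun j hj' => ?_
    interval_cases j
    · rw [show q + 0 + 1 = 0 + (q + 1) by ring, ← g0, h0, Nat.add_zero, hb]
    · rw [show q + 1 + 1 = 1 + (q + 1) by ring, ← g1, h1, show q + 1 = 0 + (q + 1) by ring, ← g0, h0]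
  · have hb' : w.getD q false = !b := Bool.eq_not_of_ne hb
    refine containsOverlap_of_shift (w := w) (d := 1) (s := q) (p := 3) (by omega) hsh (by omega)
      (by omega) fun j hj' => ?_
    interval_cases j
    · rw [show q + 0 + 3 = 2 + (q + 1) by ring, ← g2, h2, Nat.add_zero, hb']
    · rw [show q + 1 + 3 = 3 + (q + 1) by ring, ← g3, h3, show q + 1 = 0 + (q + 1) by ring, ← g0, h0]
    · rw [show q + 2 + 3 = 4 + (q + 1) by ring, ← g4, h4, show q + 2 = 1 + (q + 1) by ring, ← g1, h1]
    · rw [show q + 3 + 3 = 5 + (q + 1) by ring, ← g5, h5, show q + 3 = 2 + (q + 1) by ring, ← g2, h2]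

/-- There is an overlap-free word of length `n` that starts with some `H b` and whose reversal
starts with some `G c`. -/
def HasEnds (H G : Bool → List Bool) (n : ℕ) : Prop :=
  ∃ w b c, OverlapFree w ∧ w.length = n ∧ H b <+: w ∧ G c <+: w.reverse

def headOne (b : Bool) : List Bool := [b]

def headSquare (b : Bool) : List Bool := [b, b]

def headTwo (b : Bool) : List Bool := [b, !b]

def headThree (b : Bool) : List Bool := [b, !b, !b]

def headFour (b : Bool) : List Bool := [b, b, !b, b]

def headEight (b : Bool) : List Bool := [b, b, !b, b, b, !b, !b, b]

namespace HasEnds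

variable {H G H' G' : Bool → List Bool} {n : ℕ}

theorem symm (h : HasEnds H G n) : HasEnds G H n :=
  let ⟨w, b, c, hw, hn, hb, hc⟩ := h
  ⟨w.reverse, c, b, by simpa, by simpa, hc, by simpa⟩

theorem mono_left (h : HasEnds H G n) (hH : ∀ b, ∃ b', H' b' <+: H b) : HasEnds H' G n :=
  let ⟨w, b, c, hw, hn, hb, hc⟩ := h
  let ⟨b', hb'⟩ := hH b
  ⟨w, b', c, hw, hn, hb'.trans hb, hc⟩

theorem mu (h : HasEnds H G n) (hH : ∀ b, ∃ b', H' b' <+: mu (H b))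
    (hG : ∀ c, ∃ c', G' c' <+: _root_.mu ((G c).map not)) : HasEnds H' G' (2 * n) :=
  let ⟨w, b, c, hw, hn, hb, hc⟩ := h
  let ⟨b', hb'⟩ := hH b
  let ⟨c', hc'⟩ := hG c
  ⟨_root_.mu w, b', c', overlapFree_mu hw, by simp [hn], hb'.trans (mu_prefix hb), hc'.trans (by
    rw [mu_reverse]; exact mu_prefix (hc.map not))⟩

theorem tail (h : HasEnds H G (n + 1)) (hH : ∀ b, ∃ b', H' b' <+: (H b).tail)
    (hne : ∀ b, H b ≠ []) (hG : ∀ c, (G c).length ≤ n) : HasEnds H' G n := by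
  obtain ⟨w, b, c, hw, hn, ⟨t, rfl⟩, hc⟩ := h
  obtain ⟨b', hb'⟩ := hH b
  have hb := hne b
  cases hHb : H b with
  | nil => exact absurd hHb hb
  | cons a l =>
    rw [hHb] at hw hn hc hb'
    refine ⟨l ++ t, b', c, hw.anti ⟨[a], [], by simp⟩, by simpa using hn,
      hb'.trans (List.prefix_append _ _), ?_⟩
    refine List.prefix_of_prefix_length_le hc ⟨[a], by simp⟩ ?_
    have := hG c
    simp at hn ⊢
    omega

/-- Complementing the first letter of mu(bbb̄b) gives `headEight (!b)`, to which
`overlapFree_cons_of_head` applies. -/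
theorem flip (h : HasEnds (fun b => _root_.mu (headFour b)) G n) (hG : ∀ c, (G c).length < n) :
    HasEnds headEight G n := by
  obtain ⟨w, b, c, hw, rfl, ⟨t, rfl⟩, hc⟩ := h
  have hw' : OverlapFree ((!b) :: ([!b, !!b, !b, !b, !!b, !!b] ++ ((!b) :: t))) :=
    overlapFree_cons_of_head (hw.anti ⟨[b], [], by simp [headFour]⟩)
  refine ⟨_, !b, c, hw', by simp [headFour], ⟨t, by simp [headEight]⟩, ?_⟩
  have := hG c
  have hc' : G c <+: ([!b, !!b, !b, !b, !!b, !!b] ++ ((!b) :: t)).reverse :=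
    List.prefix_of_prefix_length_le hc ⟨[b], by simp [headFour]⟩ (by
      simp [headFour] at this ⊢; omega)
  exact hc'.trans ⟨[!b], by simp⟩

end HasEnds

/-! ### Existence of words with prescribed ends -/

theorem singleton_prefix_mu_iterate (a : Bool) (l : List Bool) (k : ℕ) :
    [a] <+: mu^[k] (a :: l) := by
  induction k with
  | zero => exact ⟨l, rfl⟩
  | succ k ih =>
    rw [Function.iterate_succ_apply']
    exact List.IsPrefix.trans ⟨[!a], rfl⟩ (mu_prefix ih)

theorem length_mu_iterate (k : ℕ) (l : List Bool) : (mu^[k] l).length = 2 ^ k * l.length := by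
  induction k with
  | zero => simp
  | succ k ih => rw [Function.iterate_succ_apply', length_mu, ih]; ring

theorem mu_iterate_prefix {l r : List Bool} (h : l <+: r) (k : ℕ) : mu^[k] l <+: mu^[k] r := by
  induction k with
  | zero => exact h
  | succ k ih => rw [Function.iterate_succ_apply', Function.iterate_succ_apply']; exact mu_prefix ih

/-- The word is the factor of length n at position i of the Thue–Morse word; the exponent 3 + (n +
i) only makes the iterate long enough. -/
theorem hasEnds_of_prefix {H : Bool → List Bool} {i b n} (hn : 1 ≤ n) (hl : (H b).length ≤ n)
    (h : H b <+: (mu^[3] [false]).drop i) : HasEnds H headOne n := by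
  have hpre : H b <+: ((mu^[3 + (n + i)] [false]).drop i).take n := by
    rw [List.prefix_take_iff]
    refine ⟨h.trans (List.IsPrefix.drop ?_ i), hl⟩
    rw [Function.iterate_add_apply]
    exact mu_iterate_prefix (singleton_prefix_mu_iterate false [] _) 3
  have hlen : (((mu^[3 + (n + i)] [false]).drop i).take n).length = n := by
    rw [List.length_take, List.length_drop, length_mu_iterate]
    have : n + i < 2 ^ (n + i) := Nat.lt_two_pow_self
    rw [pow_add]
    simp
    omega
  set w := ((mu^[3 + (n + i)] [false]).drop i).take n
  have hw : OverlapFree w := (overlapFree_mu_iterate (by decide : OverlapFree [false]) _).anti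
    ((List.take_prefix _ _).isInfix.trans (List.drop_suffix _ _).isInfix)
  cases hr : w.reverse with
  | nil =>
    rw [List.reverse_eq_nil_iff.1 hr, List.length_nil] at hlen
    omega
  | cons c l => exact ⟨w, b, c, hw, hlen, hpre, ⟨l, by simp [headOne, hr]⟩⟩

theorem hasEnds_two_two {n : ℕ} (hn : 4 ≤ n) : HasEnds headTwo headTwo n := by
  rcases Nat.even_or_odd' n with ⟨e, rfl | rfl⟩
  · exact (hasEnds_of_prefix (H := headOne) (i := 0) (b := false) (by omega) (by simp [headOne]; omega)
      (by decide)).mu (by decide) (by decide)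
  · have h : HasEnds headSquare headOne (e + 1) := hasEnds_of_prefix (i := 1) (b := true) (by omega)
      (by simp [headSquare]; omega) (by decide)
    exact (h.mu (H' := fun b => mu (headSquare b)) (G' := headTwo) (fun b => ⟨b, List.prefix_rfl⟩)
      (by decide)).tail (by decide) (by decide) (fun c => by simp [headTwo]; omega)

theorem hasEnds_two_one {n : ℕ} (hn : 2 ≤ n) : HasEnds headTwo headOne n :=
  hasEnds_of_prefix (i := 0) (b := false) (by omega) (by simpa [headTwo]) (by decide)

theorem hasEnds_four_one {n : ℕ} (hn : 4 ≤ n) : HasEnds headFour headOne n :=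
  hasEnds_of_prefix (i := 1) (b := true) (by omega) (by simpa [headFour]) (by decide)

theorem hasEnds_square_two {n : ℕ} (hn : 3 ≤ n) (h4 : n ≠ 4) (h6 : n ≠ 6) :
    HasEnds headSquare headTwo n := by
  rcases Nat.even_or_odd' n with ⟨g, rfl | rfl⟩
  · exact (((hasEnds_four_one (n := g) (by omega)).mu (H' := fun b => mu (headFour b)) (G' := headTwo)
      (fun b => ⟨b, List.prefix_rfl⟩) (by decide)).flip
        (fun c => by simp [headTwo]; omega)).mono_left (by decide)
  · exact ((hasEnds_two_one (n := g + 1) (by omega)).mu (H' := fun b => mu (headTwo b))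
      (G' := headTwo) (fun b => ⟨b, List.prefix_rfl⟩) (by decide)).tail (by decide) (by decide)
      (fun c => by simp [headTwo]; omega)

theorem hasEnds_three_two {n : ℕ} (hn : 4 ≤ n) (h7 : n ≠ 7) (h11 : n ≠ 11) :
    HasEnds headThree headTwo n := by
  rcases Nat.even_or_odd' n with ⟨e, rfl | rfl⟩
  · exact (hasEnds_two_one (n := e) (by omega)).mu (by decide) (by decide)
  · exact (((hasEnds_square_two (n := e + 1) (by omega) (by omega) (by omega)).mu
      (H' := fun b => mu (headSquare b)) (G' := headThree) (fun b => ⟨b, List.prefix_rfl⟩)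
      (by decide)).tail (by decide) (by decide) (fun c => by simp [headThree]; omega)).symm

theorem hasEnds_four_two {n : ℕ} (hn : 4 ≤ n) (h4 : n ≠ 4) (h6 : n ≠ 6) :
    HasEnds headFour headTwo n := by
  rcases Nat.even_or_odd' n with ⟨e, rfl | rfl⟩
  · exact (((hasEnds_four_one (n := e) (by omega)).mu (H' := fun b => mu (headFour b)) (G' := headTwo)
      (fun b => ⟨b, List.prefix_rfl⟩) (by decide)).flip
        (fun c => by simp [headTwo]; omega)).mono_left (by decide)
  · have h : HasEnds headThree headOne (e + 1) := hasEnds_of_prefix (i := 0) (b := false) (by omega)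
      (by simp [headThree]; omega) (by decide)
    exact (h.mu (H' := fun b => mu (headThree b)) (G' := headTwo) (fun b => ⟨b, List.prefix_rfl⟩)
      (by decide)).tail (by decide) (by decide) (fun c => by simp [headTwo]; omega)

theorem HasEnds.four_four_of_four_three {n : ℕ} (h : HasEnds headFour headThree n) (hn : 4 ≤ n) :
    HasEnds headFour headFour (2 * n - 1) := by
  have h2 := (h.mu (H' := fun b => _root_.mu (headFour b)) (G' := fun b => _root_.mu (headThree b))
    (fun b => ⟨b, List.prefix_rfl⟩) (by decide)).flip (fun c => by simp [headThree]; omega)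
  have h3 := (h2.mono_left (H' := headFour) (by decide)).symm
  rw [show 2 * n = 2 * n - 1 + 1 by omega] at h3
  exact h3.tail (by decide) (by decide) (fun c => by simp [headFour]; omega)

theorem HasEnds.eight_eight_of_four_four {n : ℕ} (h : HasEnds headFour headFour n) (hn : 5 ≤ n) :
    HasEnds headEight headEight (2 * n) := by
  have h2 := (h.mu (H' := fun b => _root_.mu (headFour b)) (G' := fun b => _root_.mu (headFour b))
    (fun b => ⟨b, List.prefix_rfl⟩) (by decide)).flip (fun c => by simp [headFour]; omega)
  exact h2.symm.flip (fun c => by simp [headEight]; omega)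

theorem HasEnds.of_list (w : List Bool) (b c : Bool) (h : OverlapFree w) (hb : headFour b <+: w)
    (hc : headFour c <+: w.reverse) : HasEnds headFour headFour w.length :=
  ⟨w, b, c, h, rfl, hb, hc⟩

theorem hasEnds_four_four_small {n : ℕ} (hn : n ∈ [10, 11, 12, 15, 23, 25, 41]) :
    HasEnds headFour headFour n := by
  simp only [List.mem_cons, List.not_mem_nil, or_false] at hn
  rcases hn with rfl | rfl | rfl | rfl | rfl | rfl | rfl
  · exact HasEnds.of_list
      [false, false, true, false, false, true, true, false, true, true]
      false true (by decide +kernel) (by decide) (by decide)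
  · exact HasEnds.of_list
      [false, false, true, false, false, true, true, false, true, false, false]
      false false (by decide +kernel) (by decide) (by decide)
  · exact HasEnds.of_list
      [false, false, true, false, false, true, true, false, false, true, false, false]
      false false (by decide +kernel) (by decide) (by decide)
  · exact HasEnds.of_list
      [false, false, true, false, false, true, true, false, true, false, false, true, false,
      true, true]
      false true (by decide +kernel) (by decide) (by decide)
  · exact HasEnds.of_list
      [false, false, true, false, false, true, true, false, true, false, false, true, false,
      true, true, false, false, true, true, false, true, false, false]
      false false (by decide +kernel) (by decide) (by decide)
  · exact HasEnds.of_list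
      [false, false, true, false, false, true, true, false, false, true, false, true, true,
      false, false, true, true, false, true, false, false, true, false, true, true]
      false true (by decide +kernel) (by decide) (by decide)
  · exact HasEnds.of_list
      [false, false, true, false, false, true, true, false, false, true, false, true, true,
      false, false, true, true, false, true, false, false, true, false, true, true, false,
      true, false, false, true, true, false, false, true, false, true, true, false, true,
      false, false]
      false false (by decide +kernel) (by decide) (by decide)

/-- Each residue mod 4 is reached by doubling, flipping and dropping end letters. The listed small
lengths are those where these steps would need unavailable shorter words. Residue 0 halves n, so
powers of 2 would descend to 16 and below 10. -/
theorem hasEnds_four_four {n : ℕ} (hn : 10 ≤ n) (hpow : ∀ k, n ≠ 2 ^ k) :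
    HasEnds headFour headFour n := by
  induction n using Nat.strong_induction_on with
  | _ n ih =>
  by_cases hs : n ∈ [10, 11, 12, 15, 23, 25, 41]
  · exact hasEnds_four_four_small hs
  simp only [List.mem_cons, List.not_mem_nil, or_false, not_or] at hs
  have h4 : n % 4 < 4 := Nat.mod_lt _ (by omega)
  interval_cases hmod : n % 4
  · have h16 : n ≠ 2 ^ 4 := hpow 4
    obtain ⟨m, rfl⟩ : ∃ m, n = 2 * m := ⟨n / 2, by omega⟩
    have hm := ih m (by omega) (by omega) fun k hk => hpow (k + 1) (by rw [hk]; ring)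
    exact ((hm.eight_eight_of_four_four (by omega)).mono_left (by decide)).symm.mono_left (by decide)
  · obtain ⟨c, rfl⟩ : ∃ c, n = 4 * c + 1 := ⟨n / 4, by omega⟩
    have h := ((hasEnds_three_two (n := c + 1) (by omega) (by omega) (by omega)).mu
      (H' := fun b => mu (headThree b)) (G' := headThree) (fun b => ⟨b, List.prefix_rfl⟩)
      (by decide)).tail (H' := headFour) (n := 2 * c + 1) (by decide) (by decide)
      (fun c => by simp [headThree]; omega)
    have h2 := h.four_four_of_four_three (by omega)
    rwa [show 2 * (2 * c + 1) - 1 = 4 * c + 1 by omega] at h2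
  · obtain ⟨c, rfl⟩ : ∃ c, n = 4 * c + 2 := ⟨n / 4, by omega⟩
    have h := ((hasEnds_two_two (n := c + 1) (by omega)).mu (H' := headThree) (G' := headThree)
      (by decide) (by decide)).mu
      (H' := fun b => mu (headThree b)) (G' := fun b => mu (headThree b))
      (fun b => ⟨b, List.prefix_rfl⟩) (by decide)
    rw [show 2 * (2 * (c + 1)) = 4 * c + 2 + 1 + 1 by ring] at h
    exact ((h.tail (H' := headFour) (by decide) (by decide)
      (fun c => by simp [headThree]; omega)).symm.tail (by decide) (by decide)
      (fun c => by simp [headFour]; omega))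
  · obtain ⟨c, rfl⟩ : ∃ c, n = 4 * c + 3 := ⟨n / 4, by omega⟩
    have h := ((hasEnds_four_two (n := c + 1) (by omega) (by omega) (by omega)).mu
      (H' := fun b => mu (headFour b)) (G' := headThree) (fun b => ⟨b, List.prefix_rfl⟩)
      (by decide)).flip (fun c => by simp [headThree]; omega)
    have h2 := (h.mono_left (H' := headFour) (by decide)).four_four_of_four_three (by omega)
    rwa [show 2 * (2 * (c + 1)) - 1 = 4 * c + 3 by omega] at h2

/-! ### Extremal words of even length -/

theorem containsOverlap_insertAt_headEight :
    ∀ b : Bool, ∀ i ≤ 5, ∀ a : Bool, ContainsOverlap (insertAt (headEight b) i a) := by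
  decide

theorem HasEnds.exists_extremal {n : ℕ} (h : HasEnds headEight headEight n) (hn : 12 ≤ n) :
    ∃ w : List Bool, w.length = n ∧ ExtremalOverlapFree w := by
  obtain ⟨w, b, c, hw, rfl, hb, hc⟩ := h
  refine ⟨w, rfl, extremalOverlapFree_of_ends hw hn (fun i hi a => ?_) fun i hi a => ?_⟩
  · exact containsOverlap_insertAt_of_prefix hb (by simp [headEight]; omega)
      (containsOverlap_insertAt_headEight b i hi a)
  · exact containsOverlap_insertAt_of_prefix hc (by simp [headEight]; omega)
      (containsOverlap_insertAt_headEight c i hi a)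

theorem extremalOverlapFree_of_insertAt {w : List Bool} (h : OverlapFree w)
    (hi : ∀ i ≤ w.length, ∀ a, ContainsOverlap (insertAt w i a)) : ExtremalOverlapFree w :=
  ⟨h, fun v hv => by
    obtain ⟨i, hle, a, rfl⟩ := isExtension_iff.1 hv
    exact hi i hle a⟩

theorem exists_extremal_ten : ∃ w : List Bool, w.length = 10 ∧ ExtremalOverlapFree w :=
  ⟨[false, false, true, false, false, true, true, false, true, true], rfl,
    extremalOverlapFree_of_insertAt (by decide) (by decide)⟩

theorem exists_extremal_twelve : ∃ w : List Bool, w.length = 12 ∧ ExtremalOverlapFree w :=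
  ⟨[false, false, true, false, false, true, true, false, false, true, false, false], rfl,
    extremalOverlapFree_of_insertAt (by decide) (by decide +kernel)⟩

/-! ### Iterates of `mu`, and the even lengths that are powers of two -/

theorem containsOverlap_cons_square {α : Type*} (c : α) (l : List α) :
    ContainsOverlap (c :: ((l ++ [c]) ++ (l ++ [c]))) :=
  ⟨_, ⟨c, l, rfl⟩, by simp⟩

theorem mu_iterate_append (k : ℕ) (l r : List Bool) : mu^[k] (l ++ r) = mu^[k] l ++ mu^[k] r := by
  induction k with
  | zero => rfl
  | succ k ih => simp only [Function.iterate_succ_apply', ih, mu_append]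

theorem mu_iterate_map_not (k : ℕ) (l : List Bool) : mu^[k] (l.map not) = (mu^[k] l).map not := by
  induction k with
  | zero => rfl
  | succ k ih => simp only [Function.iterate_succ_apply', ih, mu_map_not]

theorem mu_iterate_reverse (k : ℕ) (l : List Bool) :
    (mu^[k] l).reverse = mu^[k] l.reverse ∨ (mu^[k] l).reverse = mu^[k] (l.reverse.map not) := by
  induction k with
  | zero => exact Or.inl rfl
  | succ k ih =>
    simp only [Function.iterate_succ_apply', mu_reverse]
    rcases ih with h | h
    · exact Or.inr (by rw [h, ← mu_iterate_map_not])
    · exact Or.inl (by rw [h, ← mu_iterate_map_not, List.map_map]; simp [Function.comp_def])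

/-- The square of the word `a a ā ā`. -/
def squareSeed (a : Bool) : List Bool := [a, a, !a, !a, a, a, !a, !a]

theorem containsOverlap_insertAt_mu_iterate_two :
    ∀ a : Bool, ∀ i ≤ 5, 1 ≤ i → ∀ b : Bool,
      ContainsOverlap (insertAt (mu^[2] [a, a]) i b) := by
  decide

theorem containsOverlap_insertAt_mu_iterate_three :
    ∀ a : Bool, ∀ i ≤ 5, 1 ≤ i → ∀ b : Bool, ¬ (i = 1 ∧ b = a) →
      ContainsOverlap (insertAt (mu^[3] [a]) i b) := by
  decide

theorem mu_iterate_ne_nil (k : ℕ) {l : List Bool} (hl : l ≠ []) : mu^[k] l ≠ [] := by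
  intro h
  have := congrArg List.length h
  rw [length_mu_iterate] at this
  simp [hl] at this

/-- The word starts with the square of mu^k(a) and is itself a square. The roots of these squares
end in complementary letters, so either prepended letter completes an overlap. -/
theorem containsOverlap_cons_squareSeed (k : ℕ) (a b : Bool) :
    ContainsOverlap (b :: mu^[k] (squareSeed a)) := by
  obtain ⟨z, c, hz⟩ : ∃ z c, mu^[k] [a] = z ++ [c] := by
    rcases List.eq_nil_or_concat (mu^[k] [a]) with h | ⟨z, c, h⟩
    · exact absurd h (mu_iterate_ne_nil k (by simp))
    · exact ⟨z, c, by simpa using h⟩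
  have hz' : mu^[k] [!a] = z.map not ++ [!c] := by
    have := mu_iterate_map_not k [a]
    rw [hz] at this
    simpa using this
  have hx : mu^[k] [a, a, !a, !a] = (z ++ [c]) ++ (z ++ [c]) ++ (z.map not ++ [!c])
      ++ (z.map not ++ [!c]) := by
    rw [show [a, a, !a, !a] = [a] ++ [a] ++ [!a] ++ [!a] from rfl]
    simp only [mu_iterate_append, hz, hz']
  have hw : mu^[k] (squareSeed a) = mu^[k] [a, a, !a, !a] ++ mu^[k] [a, a, !a, !a] :=
    mu_iterate_append k [a, a, !a, !a] [a, a, !a, !a]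
  rw [hw, hx]
  by_cases hb : b = c
  · subst hb
    exact (containsOverlap_cons_square b z).mono (List.IsPrefix.isInfix ⟨_, by
      simp only [List.append_assoc, List.cons_append]; rfl⟩)
  · rw [Bool.eq_not_of_ne hb]
    have := containsOverlap_cons_square (!c)
      ((z ++ [c]) ++ (z ++ [c]) ++ (z.map not ++ [!c]) ++ z.map not)
    simpa only [List.append_assoc] using this

theorem containsOverlap_insertAt_squareSeed {k : ℕ} (hk : 2 ≤ k) (a : Bool) {i : ℕ} (hi : i ≤ 5)
    (b : Bool) : ContainsOverlap (insertAt (mu^[k] (squareSeed a)) i b) := by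
  rcases Nat.eq_zero_or_pos i with rfl | hpos
  · exact containsOverlap_cons_squareSeed k a b
  -- Inserting a after the initial a is the same as prepending it.
  by_cases hib : i = 1 ∧ b = a
  · obtain ⟨rfl, rfl⟩ := hib
    obtain ⟨t, ht⟩ := singleton_prefix_mu_iterate b [b, !b, !b, b, b, !b, !b] k
    have := containsOverlap_cons_squareSeed k b b
    rw [squareSeed, ← ht] at this ⊢
    exact this
  rcases Nat.eq_or_lt_of_le hk with rfl | hk
  · refine containsOverlap_insertAt_of_prefix
      (mu_iterate_prefix (l := [a, a]) ⟨[!a, !a, a, a, !a, !a], rfl⟩ 2) (by simp; omega)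
      (containsOverlap_insertAt_mu_iterate_two a i hi hpos b)
  · obtain ⟨m, rfl⟩ := Nat.exists_eq_add_of_le hk
    refine containsOverlap_insertAt_of_prefix (p := mu^[3] [a]) ?_
      (by rw [length_mu_iterate]; simp; omega)
      (containsOverlap_insertAt_mu_iterate_three a i hi hpos b hib)
    rw [show Nat.succ 2 + m = 3 + m from rfl, Function.iterate_add_apply]
    exact mu_iterate_prefix (singleton_prefix_mu_iterate a _ m) 3

theorem extremalOverlapFree_squareSeed {k : ℕ} (hk : 2 ≤ k) :
    ExtremalOverlapFree (mu^[k] (squareSeed false)) := by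
  refine extremalOverlapFree_of_ends (overlapFree_mu_iterate (by decide) k) ?_
    (fun i hi a => containsOverlap_insertAt_squareSeed hk false hi a) fun i hi a => ?_
  · rw [length_mu_iterate]
    have : 2 ^ 2 ≤ 2 ^ k := Nat.pow_le_pow_right (by omega) hk
    simp [squareSeed]
    omega
  · rcases mu_iterate_reverse k (squareSeed false) with h | h
    · rw [h]
      exact containsOverlap_insertAt_squareSeed hk true hi a
    · rw [h]
      exact containsOverlap_insertAt_squareSeed hk false hi a

theorem exists_extremal_even {m : ℕ} (hm : 10 ≤ m) :
    ∃ w : List Bool, w.length = 2 * m ∧ ExtremalOverlapFree w := by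
  by_cases hpow : ∃ k, m = 2 ^ k
  · obtain ⟨k, rfl⟩ := hpow
    have hk : 4 ≤ k := by
      by_contra! hk
      interval_cases k <;> omega
    obtain ⟨j, rfl⟩ := Nat.exists_eq_add_of_le hk
    refine ⟨_, ?_, extremalOverlapFree_squareSeed (k := 2 + j) (by omega)⟩
    rw [length_mu_iterate]
    simp [squareSeed, pow_add]
    ring
  · push Not at hpow
    exact ((hasEnds_four_four hm hpow).eight_eight_of_four_four (by omega)).exists_extremal
      (by omega)

/-! ### Extremal words of odd length -/

theorem getD_append_self (l : List Bool) {i : ℕ} (hi : i < 2 * l.length) :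
    (l ++ l).getD i false = l.getD (i % l.length) false := by
  rcases Nat.lt_or_ge i l.length with h | h
  · rw [List.getD_append _ _ _ _ h, Nat.mod_eq_of_lt h]
  · rw [List.getD_append_right _ _ _ _ h, Nat.mod_eq_sub_mod h, Nat.mod_eq_of_lt (by omega)]

/-- Conjugation preserves overlap-freeness of squares. -/
theorem overlapFree_square_conj {u v : List Bool} (h : OverlapFree ((u ++ v) ++ (u ++ v))) :
    OverlapFree ((v ++ u) ++ (v ++ u)) := by
  intro ho
  obtain ⟨s, p, hp, hs, hj⟩ := (containsOverlap_iff _).1 ho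
  apply h
  obtain ⟨r, hr⟩ : ∃ r, r = (u ++ v).length := ⟨_, rfl⟩
  have hr' : (v ++ u).length = r := by rw [hr]; simp [Nat.add_comm]
  rw [List.length_append, hr'] at hs
  obtain ⟨g, hg⟩ : ∃ g : ℕ → Bool, ∀ i, g i = (u ++ v).getD (i % r) false := ⟨_, fun _ => rfl⟩
  have hmod : ∀ i k, g (i % r + k) = g (i + k) := fun i k => by rw [hg, hg, Nat.mod_add_mod]
  have hadd : ∀ i, g (i + r) = g i := fun i => by rw [hg, hg, Nat.add_mod_right]
  have hw : ∀ i < 2 * r, ((u ++ v) ++ (u ++ v)).getD i false = g i := fun i hi => by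
    rw [getD_append_self _ (by omega), hg, ← hr]
  have hw' : ∀ i < 2 * r, ((v ++ u) ++ (v ++ u)).getD i false = g (i + u.length) := fun i hi => by
    have hrlen : u.length + v.length = r := by rw [hr]; simp
    have hlt : i % r < r := Nat.mod_lt _ (by omega)
    rw [getD_append_self _ (by omega), hr', ← hmod]
    obtain ⟨k, hk⟩ : ∃ k, k = i % r := ⟨_, rfl⟩
    rw [← hk] at hlt ⊢
    rcases Nat.lt_or_ge k v.length with hkv | hkv
    · rw [List.getD_append _ _ _ _ hkv, hg, Nat.mod_eq_of_lt (by omega),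
        List.getD_append_right _ _ _ _ (by omega), Nat.add_sub_cancel]
    · rw [List.getD_append_right _ _ _ _ hkv, show k + u.length = k - v.length + r by omega, hadd,
        hg, Nat.mod_eq_of_lt (by omega), List.getD_append _ _ _ _ (by omega)]
  have key : ∀ j ≤ p, g (s + u.length + j) = g (s + u.length + j + p) := fun j hj' => by
    have := hj j hj'
    rw [hw' _ (by omega), hw' _ (by omega)] at this
    rw [show s + u.length + j = s + j + u.length by ring, this]
    congr 1
    ring
  obtain ⟨t, q, hq, hqr, hper⟩ : ∃ t q, 0 < q ∧ 2 * q ≤ r ∧ ∀ j ≤ q, g (t + j) = g (t + j + q) := by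
    rcases Nat.lt_or_ge r (2 * p) with hlt | hge
    · refine ⟨s + u.length + p, r - p, by omega, by omega, fun j hj' => ?_⟩
      rw [show s + u.length + p + j + (r - p) = s + u.length + j + r by omega, hadd,
        key j (by omega)]
      congr 1
      ring
    · exact ⟨_, p, hp, hge, key⟩
  have hlt : t % r < r := Nat.mod_lt _ (by omega)
  refine (containsOverlap_iff _).2 ⟨t % r, q, hq, by rw [List.length_append, ← hr]; omega,
    fun j hj' => ?_⟩
  rw [hw _ (by omega), hw _ (by omega), Nat.add_assoc, hmod, hmod, ← Nat.add_assoc]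
  exact hper j hj'

theorem containsOverlap_insertAt_mu_iterate_four :
    ∀ x : Bool, ∀ i ≤ 5, ∀ a : Bool, (i = 0 → a = true) →
      ContainsOverlap (insertAt ([true, true, false] ++ (mu^[4] [x]).reverse) i a) := by
  decide +kernel

theorem exists_extremal_of_square {s : List Bool} (hs : OverlapFree (false :: s ++ false :: s))
    {k : ℕ} (hk : 4 ≤ k) :
    ∃ w : List Bool, w.length = 2 ^ (k + 1) * (s.length + 1) + 1 ∧ ExtremalOverlapFree w := by
  obtain ⟨j, rfl⟩ := Nat.exists_eq_add_of_le hk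
  obtain ⟨x, hx⟩ : ∃ x, x = mu^[4 + j] (false :: s) := ⟨_, rfl⟩
  have hxx : OverlapFree (x ++ x) := by
    rw [hx, ← mu_iterate_append]
    exact overlapFree_mu_iterate hs _
  have hxl : x.length = 2 ^ (4 + j) * (s.length + 1) := by rw [hx, length_mu_iterate]; simp
  rw [Function.iterate_add_apply] at hx
  obtain ⟨t, ht⟩ : mu^[4] [false] <+: x :=
    hx ▸ mu_iterate_prefix (singleton_prefix_mu_iterate false s j) 4
  obtain ⟨c, t', ht'⟩ : ∃ c t', x = t' ++ mu^[4] [c] := by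
    rcases List.eq_nil_or_concat (mu^[j] (false :: s)) with h | ⟨z, c, h⟩
    · exact absurd h (mu_iterate_ne_nil j (by simp))
    · rw [h, List.concat_eq_append, mu_iterate_append] at hx
      exact ⟨c, _, hx⟩
  -- mu^4(0) starts with 011·010011, so v starts with 010011 and 0v with `headEight false`.
  obtain ⟨v, hv⟩ : ∃ v, v = (mu^[4] [false]).drop 3 ++ t := ⟨_, rfl⟩
  have hxv : x = [false, true, true] ++ v := by rw [hv, ← ht]; rfl
  have hq : OverlapFree ((v ++ [false, true, true]) ++ (v ++ [false, true, true])) :=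
    overlapFree_square_conj (hxv ▸ hxx)
  have hw : OverlapFree (false :: ((v ++ [false, true, true]) ++ (v ++ [false, true, true]))) := by
    rw [hv] at hq ⊢
    exact overlapFree_cons_of_head (b := false) hq
  have hlen : (false :: ((v ++ [false, true, true]) ++ (v ++ [false, true, true]))).length
      = 2 ^ (4 + j + 1) * (s.length + 1) + 1 := by
    have : v.length + 3 = 2 ^ (4 + j) * (s.length + 1) := by
      rw [← hxl, hxv]; simp
    rw [pow_succ, mul_right_comm, ← this]
    simp
    omega
  refine ⟨_, hlen, extremalOverlapFree_of_ends hw ?_ (fun i hi a => ?_) fun i hi a => ?_⟩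
  · rw [hlen]
    have h1 : 2 ^ 4 ≤ 2 ^ (4 + j + 1) := Nat.pow_le_pow_right (by omega) (by omega)
    have h2 : 2 ^ (4 + j + 1) ≤ 2 ^ (4 + j + 1) * (s.length + 1) := Nat.le_mul_of_pos_right _ (by omega)
    omega
  · refine containsOverlap_insertAt_of_prefix (p := headEight false) ?_
      (by simp [headEight]; omega) (containsOverlap_insertAt_headEight false i hi a)
    rw [hv]
    exact ⟨_, rfl⟩
  · by_cases hia : i = 0 → a = true
    · refine containsOverlap_insertAt_of_prefix (p := [true, true, false] ++ (mu^[4] [c]).reverse)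
        ?_ (by simp; omega) (containsOverlap_insertAt_mu_iterate_four c i hi a hia)
      have : false :: ((v ++ [false, true, true]) ++ (v ++ [false, true, true]))
          = false :: v ++ (t' ++ mu^[4] [c]) ++ [false, true, true] := by
        rw [← ht', hxv]; simp
      rw [this]
      exact ⟨_, by simp only [List.reverse_append, List.append_assoc]; rfl⟩
    -- Appending 0 is the one case not visible locally: as v = 0v', it completes the overlap
    -- 0(v'011)0(v'011)0.
    · obtain ⟨rfl, ha⟩ : i = 0 ∧ a = false := by simpa using hia
      subst ha
      obtain ⟨v', hv'⟩ : ∃ v', v = false :: v' := ⟨_, hv⟩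
      refine (containsOverlap_cons_square false (v' ++ [false, true, true]).reverse).mono
        (List.IsPrefix.isInfix ⟨[false], ?_⟩)
      simp [insertAt, hv']

theorem exists_extremal_twentyFive : ∃ w : List Bool, w.length = 25 ∧ ExtremalOverlapFree w :=
  ⟨[false, false, true, false, false, true, true, false, false, true, false, true, true, false,
      true, false, false, true, true, false, false, true, false, true, true], rfl,
    extremalOverlapFree_of_ends (by decide +kernel) (by decide) (by decide +kernel)
      (by decide +kernel)⟩

theorem exists_extremal_fortyNine : ∃ w : List Bool, w.length = 49 ∧ ExtremalOverlapFree w :=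
  ⟨[false, false, true, false, false, true, true, false, false, true, false, true, true, false,
      false, true, true, false, true, false, false, true, false, true, true, false, true, false,
      false, true, true, false, false, true, false, true, true, false, false, true, true, false,
      true, false, false, true, false, true, true], rfl,
    extremalOverlapFree_of_ends (by decide +kernel) (by decide) (by decide +kernel)
      (by decide +kernel)⟩

theorem exists_extremal_two_pow {k : ℕ} (hk : 5 ≤ k) :
    ∃ w : List Bool, w.length = 2 ^ k + 1 ∧ ExtremalOverlapFree w := by
  obtain ⟨j, rfl⟩ : ∃ j, k = j + 1 := ⟨k - 1, by omega⟩
  simpa using exists_extremal_of_square (s := []) (by decide) (k := j) (by omega)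

theorem exists_extremal_three_mul_two_pow {k : ℕ} (hk : 3 ≤ k) :
    ∃ w : List Bool, w.length = 3 * 2 ^ k + 1 ∧ ExtremalOverlapFree w := by
  rcases Nat.lt_or_ge k 5 with h5 | h5
  · interval_cases k
    · exact exists_extremal_twentyFive
    · exact exists_extremal_fortyNine
  · obtain ⟨j, rfl⟩ : ∃ j, k = j + 1 := ⟨k - 1, by omega⟩
    have := exists_extremal_of_square (s := [true, false]) (by decide) (k := j) (by omega)
    rwa [Nat.mul_comm] at this

/-! ### The lengths of extremal overlap-free words -/

theorem theorem1p1 (n : ℕ) :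
    (∃ w : List (Fin 2), w.length = n ∧ ExtremalOverlapFree w) ↔
      n ∈ ({10, 12} ∪ {m | ∃ k : ℕ, 10 ≤ k ∧ m = 2 * k} ∪
        {m | ∃ k : ℕ, 5 ≤ k ∧ m = 2 ^ k + 1} ∪
        {m | ∃ k : ℕ, 3 ≤ k ∧ m = 3 * 2 ^ k + 1} : Set ℕ) := by
  rw [exists_extremalOverlapFree_congr finTwoEquiv]
  simp only [Set.mem_union, Set.mem_insert_iff, Set.mem_singleton_iff, Set.mem_ofPred_eq]
  constructor
  · rintro ⟨w, rfl, h⟩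
    have hge := h.length_ge
    rcases Nat.even_or_odd' w.length with ⟨m, hm | hm⟩
    · rcases hge with h10 | h12 | h20
      · exact Or.inl (Or.inl (Or.inl (Or.inl h10)))
      · exact Or.inl (Or.inl (Or.inl (Or.inr h12)))
      · exact Or.inl (Or.inl (Or.inr ⟨m, by omega, hm⟩))
    · obtain ⟨r, -, hr, k, rfl | rfl⟩ := h.length_of_odd (by omega)
      -- The smaller exponents give lengths 5, 9 and 17 here, and 13 in the next case, all excluded
      -- by `length_ge`.
      · refine Or.inl (Or.inr ⟨k + 2, ?_, by rw [hr]; ring⟩)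
        by_contra! hk
        have : k < 3 := by omega
        interval_cases k <;> omega
      · refine Or.inr ⟨k + 2, ?_, by rw [hr]; ring⟩
        by_contra! hk
        have : k = 0 := by omega
        subst this
        omega
  · rintro ((((rfl | rfl) | ⟨k, hk, rfl⟩) | ⟨k, hk, rfl⟩) | ⟨k, hk, rfl⟩)
    · exact exists_extremal_ten
    · exact exists_extremal_twelve
    · exact exists_extremal_even hk
    · exact exists_extremal_two_pow hk
    · exact exists_extremal_three_mul_two_pow hk
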